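/- For $n\ge 1$ let $C_n=\{\pm1\}^n\rtimes \mathfrak{S}_n$ be the group of signed permutations of $n$ coordinates (the symmetric group $\mathfrak{S}_n$ acting on $\{\pm1\}^n$ by permuting coordinates), i.e. the symmetry group of the $n$-dimensional hypercube, of order $2^n n!$. Let $\operatorname{End}(C_n)$ be the finite set of group homomorphisms $C_n\to C_n$, and let $\varphi$ be drawn uniformly at random from $\operatorname{End}(C_n)$. Then $$\lim_{n\to\infty}\mathbb{P}_{\varphi\in\operatorname{End}(C_n)}\big[\operatorname{im}(\varphi)\trianglelefteq C_n\big]=\lim_{n\to\infty}\frac{\#\{\varphi\in\operatorname{End}(C_n):\ \varphi(C_n)\text{ is a normal subgroup of }C_n\}}{\#\operatorname{End}(C_n)}=\frac12 .$$ -/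

import Mathlib

/-- The group `C_n = {±1}^n ⋊ S_n` of signed permutations of `n` coordinates (the symmetry group of
the `n`-dimensional hypercube): `(x, σ)` acts on `ℝⁿ` by `e_i ↦ x (σ i) • e_(σ i)`.  The symmetric
group acts on sign vectors by permuting coordinates: `(σ • x) i = x (σ⁻¹ i)`. -/
abbrev SignedPermGroup (n : ℕ) : Type :=
  SemidirectProduct (Fin n → ℤˣ) (Equiv.Perm (Fin n)) mulAutArrow

/-- The probability that a uniformly random element of the finite nonempty type `α`
satisfies `P`. -/
noncomputable def uniformProb (α : Type) [Finite α] [Nonempty α] (P : α → Prop) : ℝ :=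
  (Nat.card {a : α // P a} : ℝ) / (Nat.card α : ℝ)

instance SignedPermGroup.instFinite (n : ℕ) : Finite (SignedPermGroup n) :=
  Finite.of_equiv _ SemidirectProduct.equivProd.symm

instance SignedPermGroup.instFiniteEnd (n : ℕ) :
    Finite (SignedPermGroup n →* SignedPermGroup n) :=
  DFunLike.finite _

/-!
An endomorphism `φ` of `C_n = {±1}^n ⋊ S_n` induces an endomorphism `f` of `S_n`, by embedding `S_n`
as the complement and projecting back.

If `f` is injective and `n ≥ 7`, then `f` is conjugation by a unique `τ`, so `φ = conj τ ∘ ψ` for a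
unique endomorphism `ψ` over the identity of `S_n`. Such a `ψ` restricts to an equivariant
endomorphism of `{±1}^n`, described by one diagonal entry `a` and one off-diagonal entry `b`, and
its image is normal exactly when `a ≠ b`. The involution `ψ ↦ (x ↦ x.left * ψ x)` negates `a` and
keeps `b`, so exactly half of these endomorphisms have a normal image.

Otherwise `f`, and then `φ` because the alternating group is perfect, kills the alternating group.
Hence `φ` factors through `C_n → {±1}²`, and there are at most `16^n * #Hom({±1}², S_n)` such `φ`.
Splitting off the orbit of a point gives a recursion for `h n = #Hom({±1}², S_n)`, which shows
`16^n * h n = o(n!)`, whereas there are at least `n!` endomorphisms of the first kind.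
-/

open Equiv Filter Topology

section Transpositions

variable {α : Type*}

theorem exists_notMem_of_card_lt_natCard {s : Finset α} (h : s.card < Nat.card α) :
    ∃ x, x ∉ s := by
  by_contra! hs
  rw [← Set.ncard_univ, ← Set.eq_univ_of_forall (s := (s : Set α)) hs, Set.ncard_coe_finset] at h
  exact h.false

/-- A 3-transposition of `G`, after Fischer: an involution whose products with its conjugates have
order at most three. For `G` symmetric of degree at least seven this singles out the transpositions
by a property that automorphisms preserve. -/
def IsThreeTransposition {G : Type*} [Group G] (t : G) : Prop :=
  t ≠ 1 ∧ t * t = 1 ∧ ∀ g : G, (t * (g * t * g⁻¹)) ^ 2 = 1 ∨ (t * (g * t * g⁻¹)) ^ 3 = 1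

theorem IsThreeTransposition.map {G H : Type*} [Group G] [Group H] {t : G}
    (ht : IsThreeTransposition t) (e : G ≃* H) : IsThreeTransposition (e t) := by
  obtain ⟨h1, hsq, hconj⟩ := ht
  refine ⟨by simpa using h1, by rw [← map_mul, hsq, map_one], fun g => ?_⟩
  obtain ⟨g, rfl⟩ := e.surjective g
  simpa only [← map_inv, ← map_mul, ← map_pow, EmbeddingLike.map_eq_one_iff] using hconj g

theorem conj_apply_eq_of_apply_eq {ρ t : Perm α} {x y u v : α} (hu : ρ x = u) (hv : ρ y = v)
    (h : t x = y) : (ρ * t * ρ⁻¹) u = v := by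
  subst hu hv h
  simp

theorem pow_two_ne_one_and_pow_three_ne_one_of_path {p : Perm α} {w x y z : α} (hwx : p w = x)
    (hxy : p x = y) (hyz : p y = z) (hy : y ≠ w) (hz : z ≠ w) : p ^ 2 ≠ 1 ∧ p ^ 3 ≠ 1 := by
  constructor
  · intro h
    exact hy (by rw [← hxy, ← hwx, ← Perm.mul_apply, ← pow_two, h, Perm.one_apply])
  · intro h
    exact hz (by rw [← hyz, ← hxy, ← hwx, ← Perm.mul_apply, ← Perm.mul_apply, ← pow_two,
      ← pow_succ, h, Perm.one_apply])

theorem exists_conj_mul_pow_ne_one_of_fixed {t : Perm α} {a b c d e : α}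
    (hnd : [a, b, c, d, e].Nodup) (hab : t a = b) (hba : t b = a) (hcd : t c = d) (hdc : t d = c)
    (he : t e = e) :
    ∃ ρ : Perm α, (t * (ρ * t * ρ⁻¹)) ^ 2 ≠ 1 ∧ (t * (ρ * t * ρ⁻¹)) ^ 3 ≠ 1 := by
  classical
  simp only [List.nodup_cons, List.mem_cons, List.not_mem_nil, or_false, not_or] at hnd
  obtain ⟨ρ, hρ⟩ : ∃ ρ : Perm α, ∀ x, ρ x = swap a c (swap d e x) :=
    ⟨swap a c * swap d e, fun _ => rfl⟩
  have hd : (ρ * t * ρ⁻¹) d = d :=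
    conj_apply_eq_of_apply_eq (by grind) (by grind) he
  have hc : (ρ * t * ρ⁻¹) c = b :=
    conj_apply_eq_of_apply_eq (by grind) (by grind) hab
  have ha : (ρ * t * ρ⁻¹) a = e :=
    conj_apply_eq_of_apply_eq (by grind) (by grind) hcd
  refine ⟨ρ, pow_two_ne_one_and_pow_three_ne_one_of_path (w := d) (x := c) (y := a) (z := e)
    ?_ ?_ ?_ ?_ ?_⟩ <;> grind [Perm.mul_apply]

theorem exists_conj_mul_pow_ne_one_of_nodup {t : Perm α} {a b c d e f g k : α}
    (hnd : [a, b, c, d, e, f, g, k].Nodup) (hab : t a = b) (hdc : t d = c) (hef : t e = f)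
    (hfe : t f = e) (hgk : t g = k) (hkg : t k = g) :
    ∃ ρ : Perm α, (t * (ρ * t * ρ⁻¹)) ^ 2 ≠ 1 ∧ (t * (ρ * t * ρ⁻¹)) ^ 3 ≠ 1 := by
  classical
  simp only [List.nodup_cons, List.mem_cons, List.not_mem_nil, or_false, not_or] at hnd
  obtain ⟨ρ, hρ⟩ : ∃ ρ : Perm α, ∀ x, ρ x = swap b d (swap b f (swap b k x)) :=
    ⟨swap b d * swap b f * swap b k, fun _ => rfl⟩
  have ha : (ρ * t * ρ⁻¹) a = k :=
    conj_apply_eq_of_apply_eq (by grind) (by grind) hab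
  have hg : (ρ * t * ρ⁻¹) g = f :=
    conj_apply_eq_of_apply_eq (by grind) (by grind) hgk
  have he : (ρ * t * ρ⁻¹) e = d :=
    conj_apply_eq_of_apply_eq (by grind) (by grind) hef
  refine ⟨ρ, pow_two_ne_one_and_pow_three_ne_one_of_path (w := a) (x := g) (y := e) (z := c)
    ?_ ?_ ?_ ?_ ?_⟩ <;> grind [Perm.mul_apply]

variable [DecidableEq α]

theorem isSwap_conj {s : Perm α} (hs : s.IsSwap) (ρ : Perm α) : (ρ * s * ρ⁻¹).IsSwap := by
  obtain ⟨a, b, hab, rfl⟩ := hs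
  exact ⟨ρ a, ρ b, ρ.injective.ne hab, (swap_apply_apply ρ a b).symm⟩

theorem isSwap_mul_pow_two_or_three {s t : Perm α} (hs : s.IsSwap) (ht : t.IsSwap) :
    (s * t) ^ 2 = 1 ∨ (s * t) ^ 3 = 1 := by
  obtain ⟨a, b, hab, rfl⟩ := hs
  obtain ⟨c, d, hcd, rfl⟩ := ht
  by_cases hdisj : (a ≠ c ∧ a ≠ d) ∧ b ≠ c ∧ b ≠ d
  · left
    ext x
    simp only [pow_two, Perm.mul_apply, Perm.one_apply, swap_apply_def]
    grind
  by_cases heq : (a = c ∧ b = d) ∨ (a = d ∧ b = c)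
  · left
    ext x
    simp only [pow_two, Perm.mul_apply, Perm.one_apply, swap_apply_def]
    grind
  · right
    ext x
    simp only [pow_succ, pow_zero, Perm.mul_apply, Perm.one_apply, swap_apply_def]
    grind

theorem isThreeTransposition_of_isSwap {t : Perm α} (ht : t.IsSwap) : IsThreeTransposition t := by
  refine ⟨?_, ?_, fun ρ => isSwap_mul_pow_two_or_three ht (isSwap_conj ht ρ)⟩
  all_goals obtain ⟨a, b, hab, rfl⟩ := ht
  · exact fun h => hab (swap_eq_one_iff.1 h)
  · exact swap_mul_self a b

theorem exists_two_moved_of_not_isSwap {t : Perm α} (hinv : ∀ x, t (t x) = x) (h1 : t ≠ 1)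
    (hs : ¬ t.IsSwap) : ∃ a b c d, [a, b, c, d].Nodup ∧ t a = b ∧ t b = a ∧ t c = d ∧ t d = c := by
  obtain ⟨a, ha⟩ : ∃ a, t a ≠ a := by
    by_contra! h
    exact h1 (Perm.ext h)
  obtain ⟨c, hca, hcb, hc⟩ : ∃ c, c ≠ a ∧ c ≠ t a ∧ t c ≠ c := by
    by_contra! h
    refine hs ⟨a, t a, ha.symm, Perm.ext fun x => ?_⟩
    grind
  refine ⟨a, t a, c, t c, ?_, rfl, hinv a, rfl, hinv c⟩
  simp only [List.nodup_cons, List.mem_cons, List.not_mem_nil]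
  grind

theorem isThreeTransposition_iff_isSwap (hα : 7 ≤ Nat.card α) {t : Perm α} :
    IsThreeTransposition t ↔ t.IsSwap := by
  refine ⟨fun ⟨h1, hsq, hconj⟩ => ?_, isThreeTransposition_of_isSwap⟩
  have hinv (x : α) : t (t x) = x := by rw [← Perm.mul_apply, hsq, Perm.one_apply]
  by_contra hs
  obtain ⟨a, b, c, d, hnd, hab, hba, hcd, hdc⟩ := exists_two_moved_of_not_isSwap hinv h1 hs
  suffices ∃ ρ : Perm α, (t * (ρ * t * ρ⁻¹)) ^ 2 ≠ 1 ∧ (t * (ρ * t * ρ⁻¹)) ^ 3 ≠ 1 by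
    obtain ⟨ρ, h2, h3⟩ := this
    exact (hconj ρ).elim h2 h3
  simp only [List.nodup_cons, List.mem_cons, List.not_mem_nil, or_false, not_or] at hnd
  by_cases hfix : ∃ e, t e = e
  · obtain ⟨e, he⟩ := hfix
    refine exists_conj_mul_pow_ne_one_of_fixed ?_ hab hba hcd hdc he
    simp only [List.nodup_cons, List.mem_cons, List.not_mem_nil, or_false, not_or]
    grind
  · push Not at hfix
    obtain ⟨e, he⟩ := exists_notMem_of_card_lt_natCard (s := {a, b, c, d})
      (Finset.card_le_four.trans_lt (by lia))
    obtain ⟨g, hg⟩ := exists_notMem_of_card_lt_natCard (s := {a, b, c, d, e, t e})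
      (Finset.card_le_six.trans_lt (by lia))
    simp only [Finset.mem_insert, Finset.mem_singleton, not_or] at he hg
    have het : t e ≠ a ∧ t e ≠ b ∧ t e ≠ c ∧ t e ≠ d ∧ t e ≠ e := by grind
    have hgt : t g ≠ a ∧ t g ≠ b ∧ t g ≠ c ∧ t g ≠ d ∧ t g ≠ e ∧ t g ≠ t e ∧ t g ≠ g := by grind
    refine exists_conj_mul_pow_ne_one_of_nodup ?_ hab hdc (e := e) rfl (hinv e) (g := g) rfl
      (hinv g)
    simp only [List.nodup_cons, List.mem_cons, List.not_mem_nil, or_false, not_or]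
    grind

theorem isSwap_apply_mulAut (hα : 7 ≤ Nat.card α) (f : MulAut (Perm α)) {s : Perm α}
    (hs : s.IsSwap) : (f s).IsSwap :=
  (isThreeTransposition_iff_isSwap hα).1 ((isThreeTransposition_of_isSwap hs).map f)

theorem eq_swap_of_apply_ne {s : Perm α} (hs : s.IsSwap) {p : α} (hp : s p ≠ p) :
    s = swap p (s p) := by
  obtain ⟨a, b, -, rfl⟩ := hs
  ext x
  simp only [swap_apply_def] at *
  grind

theorem exists_eq_swap_of_not_commute {s t : Perm α} (hs : s.IsSwap) (ht : t.IsSwap)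
    (h : ¬ Commute s t) : ∃ p q r, p ≠ q ∧ p ≠ r ∧ q ≠ r ∧ s = swap p q ∧ t = swap p r := by
  obtain ⟨p, hps, hpt⟩ : ∃ p, s p ≠ p ∧ t p ≠ p := by
    by_contra! hst
    exact h (Perm.Disjoint.commute fun x => or_iff_not_imp_left.2 (hst x))
  refine ⟨p, s p, t p, hps.symm, hpt.symm, fun hst => h ?_, eq_swap_of_apply_ne hs hps,
    eq_swap_of_apply_ne ht hpt⟩
  rw [eq_swap_of_apply_ne hs hps, eq_swap_of_apply_ne ht hpt, hst]

theorem eq_swap_of_not_commute_of_not_commute {s : Perm α} (hs : s.IsSwap) {p q r : α}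
    (hqr : q ≠ r) (hp : s p = p) (hq : ¬ Commute s (swap p q)) (hr : ¬ Commute s (swap p r)) :
    s = swap q r := by
  have moved {x : α} (hx : ¬ Commute s (swap p x)) : s x ≠ x := fun hsx => hx <| by
    rw [commute_iff_eq, ← mul_inv_eq_iff_eq_mul, ← swap_apply_apply, hp, hsx]
  have hsq : s = swap q (s q) := eq_swap_of_apply_ne hs (moved hq)
  suffices s q = r by rwa [this] at hsq
  by_contra hne
  exact moved hr (by rw [hsq, swap_apply_of_ne_of_ne hqr.symm (Ne.symm hne)])

theorem exists_forall_apply_ne_of_pairwise_not_commute {ι : Type*} (hι : 4 ≤ Nat.card ι)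
    {s : ι → Perm α} (hs : ∀ i, (s i).IsSwap) (hnc : Pairwise fun i j => ¬ Commute (s i) (s j)) :
    ∃ p, ∀ i, s i p ≠ p := by
  classical
  obtain ⟨i, -⟩ := exists_notMem_of_card_lt_natCard (α := ι) (s := ∅) (by simp; lia)
  obtain ⟨j, hji⟩ := exists_notMem_of_card_lt_natCard (s := {i}) (by simp; lia)
  rw [Finset.mem_singleton] at hji
  obtain ⟨p, q, r, hpq, hpr, hqr, hi, hj⟩ :=
    exists_eq_swap_of_not_commute (hs i) (hs j) (hnc (Ne.symm hji))
  -- Non-commuting transpositions are edges sharing an endpoint. If `s k` avoids `p`, it closes the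
  -- triangle on `p, q, r`, and no fourth edge shares an endpoint with each edge of a triangle.
  refine ⟨p, fun k hkp => ?_⟩
  have hki : k ≠ i := by
    rintro rfl
    exact hpq.symm (by rw [← hkp, hi, swap_apply_left])
  have hkj : k ≠ j := by
    rintro rfl
    exact hpr.symm (by rw [← hkp, hj, swap_apply_left])
  have triangle {l : ι} (hli : l ≠ i) (hlj : l ≠ j) (hlp : s l p = p) : s l = swap q r :=
    eq_swap_of_not_commute_of_not_commute (hs l) hqr hlp (hi ▸ hnc hli) (hj ▸ hnc hlj)
  have hk : s k = swap q r := triangle hki hkj hkp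
  obtain ⟨l, hl⟩ := exists_notMem_of_card_lt_natCard (s := {i, j, k})
    (Finset.card_le_three.trans_lt (by lia))
  simp only [Finset.mem_insert, Finset.mem_singleton, not_or] at hl
  obtain ⟨hli, hlj, hlk⟩ := hl
  by_cases hlp : s l p = p
  · exact hnc hlk (by rw [triangle hli hlj hlp, hk])
  by_cases hlq : s l q = q
  · refine hnc hlj ?_
    rw [eq_swap_of_not_commute_of_not_commute (hs l) hpr hlq (swap_comm p q ▸ hi ▸ hnc hli)
      (hk ▸ hnc hlk), hj]
  · refine hnc hli ?_
    have hlpq : s l p = q := by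
      rw [eq_swap_of_apply_ne (hs l) hlp] at hlq
      grind
    rw [eq_swap_of_apply_ne (hs l) hlp, hlpq, hi]

theorem not_commute_swap_swap {o x y : α} (hx : x ≠ o) (hy : y ≠ o) (hxy : x ≠ y) :
    ¬ Commute (swap o x) (swap o y) := fun h => by
  have := congr($(h.eq) x)
  simp only [Perm.mul_apply] at this
  grind

theorem exists_mulAut_apply_swap_eq_swap (hα : 7 ≤ Nat.card α) (f : MulAut (Perm α)) (o : α) :
    ∃ τ : Perm α, ∀ x, f (swap o x) = swap (τ o) (τ x) := by
  have := Nat.finite_of_card_ne_zero (α := α) (by lia)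
  have hswap {x : α} (hx : x ≠ o) : (f (swap o x)).IsSwap :=
    isSwap_apply_mulAut hα f ⟨o, x, hx.symm, rfl⟩
  obtain ⟨p, hp⟩ : ∃ p, ∀ x : {x // x ≠ o}, f (swap o x) p ≠ p := by
    refine exists_forall_apply_ne_of_pairwise_not_commute ?_ (fun x => hswap x.2) fun x y hxy => ?_
    · have := Fintype.ofFinite α
      rw [Nat.card_eq_fintype_card] at hα ⊢
      rw [Fintype.card_subtype_compl, Fintype.card_subtype_eq]
      lia
    · change ¬ Commute _ _
      rw [commute_iff_eq, ← map_mul, ← map_mul, f.injective.eq_iff]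
      exact not_commute_swap_swap x.2 y.2 (Subtype.coe_injective.ne hxy)
  have hfp (x : α) : f (swap o x) = swap p (f (swap o x) p) := by
    by_cases hx : x = o
    · simp [hx, ← Perm.one_def]
    · exact eq_swap_of_apply_ne (hswap hx) (hp ⟨x, hx⟩)
  have hinj : Function.Injective fun x => f (swap o x) p := fun x y hxy => by
    have h : f (swap o x) = f (swap o y) := by rw [hfp x, hfp y]; exact congrArg (swap p) hxy
    simpa using congr($(f.injective h) o)
  refine ⟨Equiv.ofBijective _ (Finite.injective_iff_bijective.1 hinj), fun x => ?_⟩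
  simpa [← Perm.one_def] using hfp x

end Transpositions

section InnerAutomorphisms

variable {α : Type*}

theorem mulAut_conj_surjective (hα : 7 ≤ Nat.card α) :
    Function.Surjective (MulAut.conj : Perm α →* MulAut (Perm α)) := by
  classical
  intro f
  have := Nat.finite_of_card_ne_zero (α := α) (by lia)
  obtain ⟨o, -⟩ := exists_notMem_of_card_lt_natCard (α := α) (s := ∅) (by simp; lia)
  obtain ⟨τ, hτ⟩ := exists_mulAut_apply_swap_eq_swap hα f o
  refine ⟨τ, MulEquiv.toMonoidHom_injective (MonoidHom.eq_of_eqOn_dense Perm.closure_isSwap ?_)⟩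
  rintro _ ⟨x, y, hxy, rfl⟩
  have hconj (x y : α) : MulAut.conj τ (swap x y) = swap (τ x) (τ y) := by
    rw [MulAut.conj_apply, swap_apply_apply]
  change MulAut.conj τ (swap x y) = f (swap x y)
  by_cases hy : y = o
  · rw [hy, swap_comm, hτ, hconj]
  · rw [← swap_mul_swap_mul_swap (x := y) (y := o) (z := x) hy hxy.symm, swap_comm y o]
    simp only [map_mul, hτ, hconj]

theorem mulAut_conj_injective (hα : 3 ≤ Nat.card α) :
    Function.Injective (MulAut.conj : Perm α →* MulAut (Perm α)) := by
  classical
  rw [injective_iff_map_eq_one]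
  intro ρ hρ
  by_contra! hne
  obtain ⟨x, hx⟩ : ∃ x, ρ x ≠ x := by
    by_contra! h
    exact hne (Perm.ext h)
  obtain ⟨y, hy⟩ := exists_notMem_of_card_lt_natCard (s := {x, ρ x})
    (Finset.card_le_two.trans_lt (by lia))
  have h : swap (ρ x) (ρ y) = swap x y := by
    rw [swap_apply_apply, ← MulAut.conj_apply, hρ, MulAut.one_apply]
  simp only [Finset.mem_insert, Finset.mem_singleton, not_or] at hy
  have := congr($h (ρ x))
  grind [ρ.injective.eq_iff]

end InnerAutomorphisms

section RealSequence

open Finset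

variable {b c : ℕ → ℝ} {d : ℕ}

-- The terms with `n < k` contribute `c k * b 0`, by truncated subtraction.
theorem sum_mul_le_sum_mul_of_forall_le (hc : ∀ k, 0 ≤ c k) {n : ℕ} {M : ℝ}
    (hM : ∀ i ≤ n, b i ≤ M) :
    ∑ k ∈ range d, c k * b (n - k) ≤ (∑ k ∈ range d, c k) * M := by
  rw [Finset.sum_mul]
  exact Finset.sum_le_sum fun k _ => mul_le_mul_of_nonneg_left (hM _ (Nat.sub_le n k)) (hc k)

theorem exists_forall_le_of_succ_mul_le_sum (hb : ∀ n, 0 ≤ b n) (hc : ∀ k, 0 ≤ c k)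
    (h : ∀ n : ℕ, (n + 1) * b (n + 1) ≤ ∑ k ∈ range d, c k * b (n - k)) :
    ∃ M, ∀ n, b n ≤ M := by
  obtain ⟨N, hN⟩ := exists_nat_ge (∑ k ∈ range d, c k)
  refine ⟨∑ i ∈ range (N + 1), b i, fun n => ?_⟩
  induction n using Nat.strong_induction_on with
  | _ n ih =>
    rcases lt_or_ge n (N + 1) with hn | hn
    · exact single_le_sum (f := b) (fun i _ => hb i) (mem_range.2 hn)
    obtain ⟨m, rfl⟩ : ∃ m, n = m + 1 := ⟨n - 1, by lia⟩
    set M := ∑ i ∈ range (N + 1), b i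
    have hM : 0 ≤ M := sum_nonneg fun i _ => hb i
    have hNm : (N : ℝ) ≤ m + 1 := by exact_mod_cast (by lia : N ≤ m + 1)
    refine le_of_mul_le_mul_left (a := (m + 1 : ℝ)) ?_ (by positivity)
    calc (m + 1) * b (m + 1) ≤ ∑ k ∈ range d, c k * b (m - k) := h m
      _ ≤ (∑ k ∈ range d, c k) * M :=
        sum_mul_le_sum_mul_of_forall_le hc fun i hi => ih i (Nat.lt_succ_of_le hi)
      _ ≤ (m + 1) * M := by gcongr; exact hN.trans hNm

theorem tendsto_zero_of_succ_mul_le_sum (hb : ∀ n, 0 ≤ b n) (hc : ∀ k, 0 ≤ c k)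
    (h : ∀ n : ℕ, (n + 1) * b (n + 1) ≤ ∑ k ∈ range d, c k * b (n - k)) :
    Tendsto b atTop (𝓝 0) := by
  obtain ⟨M, hM⟩ := exists_forall_le_of_succ_mul_le_sum hb hc h
  rw [← tendsto_add_atTop_iff_nat 1]
  refine squeeze_zero (fun n => hb (n + 1)) (fun n => ?_)
    ((tendsto_add_atTop_iff_nat 1).2 (tendsto_const_div_atTop_nhds_zero_nat
      ((∑ k ∈ range d, c k) * M)))
  rw [Nat.cast_add_one, le_div_iff₀' (by positivity)]
  exact (h n).trans (sum_mul_le_sum_mul_of_forall_le hc fun i _ => hM i)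

end RealSequence

section CountingPermutationRepresentations

variable {G α : Type*} [Group G]

/-- The action of `G` on an invariant subset `{a // p a}` of a set `α` on which `G` acts through
`ρ`. -/
def restrictPerm (ρ : G →* Perm α) {p : α → Prop} (hp : ∀ g a, p (ρ g a) ↔ p a) :
    G →* Perm {a // p a} where
  toFun g := (ρ g).subtypePerm (hp g)
  map_one' := Perm.ext fun a => Subtype.ext (by simp)
  map_mul' g g' := by simp only [map_mul, Perm.subtypePerm_mul]

theorem eq_of_restrictPerm_eq {ρ ρ' : G →* Perm α} {p : α → Prop} (hp : ∀ g a, p (ρ g a) ↔ p a)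
    (hp' : ∀ g a, p (ρ' g a) ↔ p a) (h : restrictPerm ρ hp = restrictPerm ρ' hp') (g : G) {a : α}
    (ha : p a) : ρ g a = ρ' g a :=
  congrArg Subtype.val congr($h g ⟨a, ha⟩)

theorem natCard_invariant_le [Finite G] [Finite α] (p : α → Prop) :
    Nat.card {ρ : G →* Perm α // ∀ g a, p (ρ g a) ↔ p a} ≤
      Nat.card (G →* Perm {a // p a}) * Nat.card (G →* Perm {a // ¬ p a}) := by
  rw [← Nat.card_prod]
  have (β : Type _) [Finite β] : Finite (G →* Perm β) := DFunLike.finite _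
  have hneg (ρ : {ρ : G →* Perm α // ∀ g a, p (ρ g a) ↔ p a}) (g : G) (a : α) :
      ¬ p (ρ.1 g a) ↔ ¬ p a := not_congr (ρ.2 g a)
  refine Nat.card_le_card_of_injective
    (fun ρ => (restrictPerm ρ.1 ρ.2, restrictPerm ρ.1 (hneg ρ))) fun ρ ρ' h => ?_
  obtain ⟨hpos, hnot⟩ := Prod.ext_iff.1 h
  refine Subtype.ext (MonoidHom.ext fun g => Perm.ext fun a => ?_)
  by_cases ha : p a
  · exact eq_of_restrictPerm_eq ρ.2 ρ'.2 hpos g ha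
  · exact eq_of_restrictPerm_eq (hneg ρ) (hneg ρ') hnot g ha

theorem natCard_monoidHom_perm_eq {n : ℕ} [Finite α] (hα : Nat.card α = n) :
    Nat.card (G →* Perm α) = Nat.card (G →* Perm (Fin n)) :=
  Nat.card_congr (Finite.equivFinOfCardEq hα).permCongrHom.monoidHomCongrRightEquiv

theorem natCard_orbit_eq_le [Finite G] {n : ℕ} {x : Fin (n + 1)}
    {T : Finset (Fin (n + 1))} (hx : x ∉ T) :
    Nat.card {ρ : G →* Perm (Fin (n + 1)) // Set.range (fun g => ρ g x) = insert x T} ≤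
      Nat.card (G →* Perm (Fin (T.card + 1))) * Nat.card (G →* Perm (Fin (n - T.card))) := by
  have hmem : Nat.card {a // a ∈ insert x T} = T.card + 1 := by
    rw [Nat.card_eq_fintype_card, Fintype.card_coe, Finset.card_insert_of_notMem hx]
  have hnot : Nat.card {a // ¬ a ∈ insert x T} = n - T.card := by
    rw [Nat.card_eq_fintype_card, Fintype.card_subtype_compl, Fintype.card_fin, Fintype.card_coe,
      Finset.card_insert_of_notMem hx, Nat.add_sub_add_right]
  rw [← natCard_monoidHom_perm_eq hmem, ← natCard_monoidHom_perm_eq hnot]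
  have : Finite (G →* Perm (Fin (n + 1))) := DFunLike.finite _
  refine (Nat.card_le_card_of_injective (Subtype.map id fun ρ hρ g a => ?_)
    (Subtype.map_injective _ Function.injective_id)).trans (natCard_invariant_le (· ∈ insert x T))
  rw [← Finset.mem_coe, ← Finset.mem_coe, ← hρ]
  constructor
  · rintro ⟨g', hg'⟩
    exact ⟨g⁻¹ * g', by simpa [Equiv.symm_apply_eq] using hg'⟩
  · rintro ⟨g', rfl⟩
    exact ⟨g * g', by simp⟩

theorem natCard_monoidHom_perm_succ_le [Finite G] (n : ℕ) :
    Nat.card (G →* Perm (Fin (n + 1))) ≤ ∑ k ∈ Finset.range (Nat.card G), n.choose k *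
      (Nat.card (G →* Perm (Fin (k + 1))) * Nat.card (G →* Perm (Fin (n - k)))) := by
  classical
  have := Fintype.ofFinite G
  have : Finite (G →* Perm (Fin (n + 1))) := DFunLike.finite _
  have := Fintype.ofFinite (G →* Perm (Fin (n + 1)))
  let subsets (k : ℕ) : Finset (Finset (Fin (n + 1))) := (Finset.univ.erase 0).powersetCard k
  let withOrbit (T : Finset (Fin (n + 1))) : Finset (G →* Perm (Fin (n + 1))) :=
    {ρ | Set.range (fun g => ρ g 0) = insert 0 T}
  have hcover : Finset.univ ⊆
      ((Finset.range (Nat.card G)).biUnion subsets).biUnion withOrbit := fun ρ _ => by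
    have h0 : (0 : Fin (n + 1)) ∈ Finset.univ.image fun g => ρ g 0 :=
      Finset.mem_image.2 ⟨1, Finset.mem_univ _, by simp⟩
    simp only [Finset.mem_biUnion, Finset.mem_range, subsets, withOrbit, Finset.mem_powersetCard,
      Finset.mem_filter, Finset.mem_univ, true_and]
    refine ⟨(Finset.univ.image fun g => ρ g 0).erase 0, ⟨_, ?_, Finset.erase_subset_erase _
      (Finset.subset_univ _), rfl⟩, ?_⟩
    · rw [Nat.card_eq_fintype_card]
      exact (Finset.card_erase_lt_of_mem h0).trans_le Finset.card_image_le
    · rw [Finset.insert_erase h0, Finset.coe_image, Finset.coe_univ,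
        Set.image_univ]
  have hcard {k : ℕ} {T : Finset (Fin (n + 1))} (hT : T ∈ subsets k) : (withOrbit T).card ≤
      Nat.card (G →* Perm (Fin (k + 1))) * Nat.card (G →* Perm (Fin (n - k))) := by
    obtain ⟨hsub, rfl⟩ := Finset.mem_powersetCard.1 hT
    rw [← Fintype.card_subtype, ← Nat.card_eq_fintype_card]
    exact natCard_orbit_eq_le fun h => Finset.notMem_erase 0 _ (hsub h)
  rw [Finset.biUnion_biUnion] at hcover
  rw [Nat.card_eq_fintype_card (α := G →* Perm (Fin (n + 1))), ← Finset.card_univ]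
  refine (Finset.card_le_card hcover).trans (Finset.card_biUnion_le.trans ?_)
  refine Finset.sum_le_sum fun k _ =>
    (Finset.card_biUnion_le_card_mul _ _ _ fun T => hcard).trans ?_
  simp [subsets]

theorem tendsto_natCard_monoidHom_perm_mul_pow_div_factorial (G : Type*) [Group G] [Finite G]
    {K : ℝ} (hK : 0 ≤ K) :
    Tendsto (fun n : ℕ => Nat.card (G →* Perm (Fin n)) * K ^ n / n.factorial) atTop (𝓝 0) := by
  let b (n : ℕ) : ℝ := Nat.card (G →* Perm (Fin n)) * K ^ n / n.factorial
  refine tendsto_zero_of_succ_mul_le_sum (b := b) (c := fun k => (k + 1) * b (k + 1))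
    (d := Nat.card G) (fun n => by positivity) (fun k => by positivity) fun n => ?_
  have hsucc (m : ℕ) : (m + 1) * b (m + 1) =
      Nat.card (G →* Perm (Fin (m + 1))) * K ^ (m + 1) / m.factorial := by
    simp only [b, Nat.factorial_succ]
    push_cast
    field_simp
  have hterm (k : ℕ) : (n.choose k * (Nat.card (G →* Perm (Fin (k + 1))) *
      Nat.card (G →* Perm (Fin (n - k)))) : ℝ) * (K ^ (n + 1) / n.factorial) ≤
        (k + 1) * b (k + 1) * b (n - k) := by
    rcases lt_or_ge n k with hkn | hkn
    · rw [Nat.choose_eq_zero_of_lt hkn]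
      simp only [CharP.cast_eq_zero, zero_mul]
      positivity
    · refine le_of_eq ?_
      have hpow : K ^ (n + 1) = K ^ (k + 1) * K ^ (n - k) := by rw [← pow_add]; congr 1; lia
      rw [hsucc, Nat.cast_choose ℝ hkn, hpow]
      simp only [b]
      field_simp
  calc (n + 1) * b (n + 1)
      = Nat.card (G →* Perm (Fin (n + 1))) * (K ^ (n + 1) / n.factorial) := by
        rw [hsucc, mul_div_assoc]
    _ ≤ (∑ k ∈ Finset.range (Nat.card G), (n.choose k * (Nat.card (G →* Perm (Fin (k + 1))) *
        Nat.card (G →* Perm (Fin (n - k)))) : ℝ)) * (K ^ (n + 1) / n.factorial) := by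
        gcongr
        exact_mod_cast natCard_monoidHom_perm_succ_le (G := G) n
    _ ≤ _ := by
        rw [Finset.sum_mul]
        exact Finset.sum_le_sum fun k _ => hterm k

end CountingPermutationRepresentations

section SemidirectProducts

open SemidirectProduct

theorem natCard_monoidHom_semidirectProduct_le {K N G : Type*} [Group K] [Group N] [Group G]
    [Finite K] [Finite N] [Finite G] (φ : G →* MulAut N) :
    Nat.card (K →* N ⋊[φ] G) ≤ Nat.card N ^ Nat.card K * Nat.card (K →* G) := by
  have : Finite (K →* G) := DFunLike.finite _
  rw [← Nat.card_fun, ← Nat.card_prod]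
  refine Nat.card_le_card_of_injective (fun ψ => (fun k => (ψ k).left, rightHom.comp ψ))
    fun ψ ψ' h => ?_
  obtain ⟨hleft, hright⟩ := Prod.ext_iff.1 h
  exact MonoidHom.ext fun k => SemidirectProduct.ext (congrFun hleft k) congr($hright k)

variable {N G : Type*} [CommGroup N] [Group G] {φ : G →* MulAut N}

theorem mul_inl_mul_inv (x : N ⋊[φ] G) (v : N) : x * inl v * x⁻¹ = inl (φ x.right v) := by
  rw [mul_inv_eq_iff_eq_mul]
  exact SemidirectProduct.ext (by simp [mul_comm]) (by simp)

theorem normal_iff_forall_inl_mul_inv_mem {H : Subgroup (N ⋊[φ] G)}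
    (hH : H.map rightHom = ⊤) : H.Normal ↔ ∀ g v, inl (v * (φ g v)⁻¹) ∈ H := by
  have hlift (g : G) : ∃ y ∈ H, y.right = g := by
    simpa using hH.ge (Subgroup.mem_top g)
  have hcomm (y : N ⋊[φ] G) (v : N) : inl (v * (φ y.right v)⁻¹) = inl v * y * (inl v)⁻¹ * y⁻¹ := by
    rw [map_mul, map_inv, ← mul_inl_mul_inv]
    group
  refine ⟨fun hN g v => ?_, fun h => ⟨fun y hy x => ?_⟩⟩
  · obtain ⟨y, hy, rfl⟩ := hlift g
    rw [hcomm]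
    exact mul_mem (hN.conj_mem y hy _) (inv_mem hy)
  · obtain ⟨z, hz, hzx⟩ := hlift x.right
    obtain ⟨v, rfl⟩ : ∃ v, x = inl v * z := by
      refine ⟨(x * z⁻¹).left, ?_⟩
      rw [← mul_inv_eq_iff_eq_mul]
      exact SemidirectProduct.ext rfl (by simp [hzx])
    have hzy : z * y * z⁻¹ ∈ H := mul_mem (mul_mem hz hy) (inv_mem hz)
    have : inl v * z * y * (inl v * z)⁻¹ =
        inl (v * (φ (z * y * z⁻¹).right v)⁻¹) * (z * y * z⁻¹) := by
      rw [hcomm]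
      group
    rw [this]
    exact mul_mem (h _ v) hzy

variable {ψ : N ⋊[φ] G →* N ⋊[φ] G}

theorem right_apply_eq_right (hψ : rightHom.comp ψ = rightHom) (x : N ⋊[φ] G) :
    (ψ x).right = x.right :=
  congr($hψ x)

theorem map_rightHom_range_eq_top (hψ : rightHom.comp ψ = rightHom) :
    ψ.range.map rightHom = ⊤ := by
  rw [MonoidHom.map_range, hψ, MonoidHom.range_eq_top]
  exact rightHom_surjective

variable (hψ : rightHom.comp ψ = rightHom)

/-- The restriction to the kernel `N` of an endomorphism of `N ⋊[φ] G` that lies over the identity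
of `G`. -/
def restrictInl : N →* N where
  toFun v := (ψ (inl v)).left
  map_one' := by simp
  map_mul' v w := by simp [right_apply_eq_right hψ]

theorem inl_restrictInl (v : N) : inl (restrictInl hψ v) = ψ (inl v) :=
  SemidirectProduct.ext rfl ((right_apply_eq_right hψ (inl v)).trans (right_inl v)).symm

theorem restrictInl_aut (g : G) (v : N) : restrictInl hψ (φ g v) = φ g (restrictInl hψ v) := by
  apply inl_injective (φ := φ)
  rw [inl_restrictInl, inl_aut, map_mul, map_mul, map_inv inr, map_inv ψ, ← inl_restrictInl hψ,
    mul_inl_mul_inv, right_apply_eq_right hψ, right_inr]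

theorem inl_mem_range_iff {v : N} : inl v ∈ ψ.range ↔ v ∈ (restrictInl hψ).range := by
  constructor
  · rintro ⟨x, hx⟩
    have hx1 : x = inl x.left := SemidirectProduct.ext rfl <| by
      rw [← right_apply_eq_right hψ, hx, right_inl, right_inl]
    refine ⟨x.left, inl_injective (φ := φ) ?_⟩
    rw [inl_restrictInl, ← hx1, hx]
  · rintro ⟨w, rfl⟩
    exact ⟨inl w, (inl_restrictInl hψ w).symm⟩

/-- The product of an endomorphism of `N ⋊[φ] G` lying over the identity of `G` with the crossed
homomorphism `x ↦ x.left`. It lies over the identity again. -/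
def twist : N ⋊[φ] G →* N ⋊[φ] G where
  toFun x := inl x.left * ψ x
  map_one' := by simp
  map_mul' x y := by
    rw [mul_left, map_mul, map_mul, ← right_apply_eq_right hψ x, ← mul_inl_mul_inv]
    group

theorem rightHom_comp_twist : rightHom.comp (twist hψ) = rightHom :=
  MonoidHom.ext fun x => by simp [twist, right_apply_eq_right hψ]

theorem restrictInl_twist (v : N) :
    restrictInl (rightHom_comp_twist hψ) v = v * restrictInl hψ v := by
  simp [restrictInl, twist]

theorem twist_twist (hN : ∀ v : N, v * v = 1) : twist (rightHom_comp_twist hψ) = ψ :=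
  MonoidHom.ext fun x => by
    change inl x.left * (inl x.left * ψ x) = ψ x
    rw [← mul_assoc, ← map_mul, hN, map_one, one_mul]

end SemidirectProducts

section PerfectAlternatingGroup

variable {α : Type*} [Fintype α] [DecidableEq α]

theorem alternatingGroup_le_ker_of_forall_commute (hα : 5 ≤ Nat.card α) {K : Type*} [Group K]
    {f : Perm α →* K}
    (h : ∀ σ ∈ alternatingGroup α, ∀ ρ ∈ alternatingGroup α, Commute (f σ) (f ρ)) :
    alternatingGroup α ≤ f.ker := by
  rw [← commutator_alternatingGroup_eq_self hα, Subgroup.commutator_le]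
  intro σ hσ ρ hρ
  rw [MonoidHom.mem_ker, map_commutatorElement, commutatorElement_eq_one_iff_commute]
  exact h σ hσ ρ hρ

theorem alternatingGroup_le_ker_of_not_injective (hα : 5 ≤ Nat.card α) {K : Type*} [Group K]
    {f : Perm α →* K} (hf : ¬ Function.Injective f) : alternatingGroup α ≤ f.ker := by
  refine Perm.alternatingGroup_le_of_normal hα ?_
  rwa [Subgroup.nontrivial_iff_ne_bot, Ne, MonoidHom.ker_eq_bot_iff]

open SemidirectProduct in
theorem alternatingGroup_le_ker_of_rightHom_comp (hα : 5 ≤ Nat.card α) {N G : Type*} [CommGroup N]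
    [Group G] {φ : G →* MulAut N} {f : Perm α →* N ⋊[φ] G}
    (h : alternatingGroup α ≤ (rightHom.comp f).ker) : alternatingGroup α ≤ f.ker := by
  have hinl {σ : Perm α} (hσ : σ ∈ alternatingGroup α) : f σ ∈ (inl : N →* N ⋊[φ] G).range := by
    rw [range_inl_eq_ker_rightHom]
    exact h hσ
  refine alternatingGroup_le_ker_of_forall_commute hα fun σ hσ ρ hρ => ?_
  obtain ⟨v, hv⟩ := hinl hσ
  obtain ⟨w, hw⟩ := hinl hρ
  rw [← hv, ← hw]
  exact (Commute.all v w).map inl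

end PerfectAlternatingGroup

theorem eq_bot_of_normal_of_forall_commute {α : Type*} (hα : 5 ≤ Nat.card α)
    {H : Subgroup (Perm α)} (hnormal : H.Normal)
    (hcomm : ∀ σ ∈ H, ∀ ρ ∈ H, Commute σ ρ) : H = ⊥ := by
  classical
  have := Nat.finite_of_card_ne_zero (α := α) (by lia)
  have := Fintype.ofFinite α
  by_contra hH
  have hle : alternatingGroup α ≤ H :=
    Perm.alternatingGroup_le_of_normal hα ((Subgroup.nontrivial_iff_ne_bot H).2 hH)
  have hbot : alternatingGroup α ≤ (MonoidHom.id (Perm α)).ker :=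
    alternatingGroup_le_ker_of_forall_commute hα fun σ hσ ρ hρ => hcomm σ (hle hσ) ρ (hle hρ)
  have : Nontrivial (alternatingGroup α) :=
    alternatingGroup.nontrivial_of_three_le_card (by lia)
  exact (Subgroup.nontrivial_iff_ne_bot _).1 this (le_bot_iff.1 hbot)

open SemidirectProduct in
theorem comp_inl_eq_one_of_surjective {α : Type*} (hα : 5 ≤ Nat.card α) {N G : Type*}
    [CommGroup N] [Group G] {φ : G →* MulAut N}
    {θ : N ⋊[φ] G →* Perm α} (hθ : Function.Surjective (θ.comp inr)) :
    θ.comp inl = 1 := by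
  rw [← MonoidHom.range_eq_bot_iff]
  refine eq_bot_of_normal_of_forall_commute hα ⟨?_⟩ ?_
  · rintro _ ⟨v, rfl⟩ σ
    obtain ⟨g, rfl⟩ := hθ σ
    refine ⟨φ g v, ?_⟩
    simp only [MonoidHom.comp_apply, inl_aut, map_mul, map_inv]
  · rintro _ ⟨v, rfl⟩ _ ⟨w, rfl⟩
    exact (Commute.all v w).map (θ.comp inl)

section SignVectors

variable {α : Type*} [DecidableEq α]

/-- The sign vector whose only negative entry is in place `i`; these generate the group of all sign
vectors. -/
abbrev signFlip (i : α) : α → ℤˣ :=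
  Pi.mulSingle i (-1)

theorem mulAutArrow_mulSingle {M : Type*} [Monoid M] (σ : Perm α) (i : α) (x : M) :
    mulAutArrow σ (Pi.mulSingle i x : α → M) = Pi.mulSingle (σ i) x := by
  ext j
  change (Pi.mulSingle i x : α → M) (σ⁻¹ j) = _
  rw [Pi.mulSingle_apply, Pi.mulSingle_apply]
  simp only [Perm.inv_eq_iff_eq]

theorem mem_of_forall_signFlip_mem [Finite α] {H : Subgroup (α → ℤˣ)} (h : ∀ i, signFlip i ∈ H)
    (v : α → ℤˣ) : v ∈ H := by
  refine Subgroup.pi_mem_of_mulSingle_mem v fun i => ?_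
  rcases Int.units_eq_one_or (v i) with hi | hi
  · rw [hi, Pi.mulSingle_one]
    exact H.one_mem
  · rw [hi]
    exact h i

variable {L : (α → ℤˣ) →* (α → ℤˣ)}
  (hL : ∀ (σ : Perm α) v, L (mulAutArrow σ v) = mulAutArrow σ (L v))

include hL

theorem apply_signFlip_perm (σ : Perm α) (i j : α) :
    L (signFlip (σ i)) (σ j) = L (signFlip i) j := by
  rw [signFlip, ← mulAutArrow_mulSingle, hL]
  exact congrArg (L (signFlip i)) (σ.symm_apply_apply j)

theorem apply_signFlip_self (i k : α) : L (signFlip k) k = L (signFlip i) i := by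
  simpa using apply_signFlip_perm hL (swap i k) i i

theorem apply_signFlip_of_ne {i j k l : α} (hij : i ≠ j) (hkl : k ≠ l) :
    L (signFlip k) l = L (signFlip i) j := by
  obtain ⟨σ, rfl, rfl⟩ := MulAction.is_two_pretransitive_iff.1
    (Equiv.Perm.isMultiplyPretransitive α 2) hij hkl
  exact apply_signFlip_perm hL σ i j

theorem apply_signFlip_mul_signFlip {i j : α} (hij : i ≠ j)
    (hne : L (signFlip i) i ≠ L (signFlip i) j) {p q : α} (hpq : p ≠ q) :
    L (signFlip p * signFlip q) = signFlip p * signFlip q := by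
  have hneg : L (signFlip i) i = -L (signFlip i) j := Int.units_ne_iff_eq_neg.1 hne
  ext1 k
  rw [map_mul, Pi.mul_apply, Pi.mul_apply]
  by_cases hp : p = k
  · subst hp
    rw [apply_signFlip_self hL i p, apply_signFlip_of_ne hL hij hpq.symm, hneg]
    simp [Pi.mulSingle_eq_of_ne hpq, Int.units_mul_self]
  by_cases hq : q = k
  · subst hq
    rw [apply_signFlip_self hL i q, apply_signFlip_of_ne hL hij hpq, hneg]
    simp [Pi.mulSingle_eq_of_ne hpq.symm, Int.units_mul_self]
  · rw [apply_signFlip_of_ne hL hij hp, apply_signFlip_of_ne hL hij hq, Int.units_mul_self]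
    simp [Pi.mulSingle_eq_of_ne' hp, Pi.mulSingle_eq_of_ne' hq]

theorem apply_eq_apply_of_signFlip_eq [Finite α] {i j : α} (hij : i ≠ j)
    (heq : L (signFlip i) i = L (signFlip i) j) (v : α → ℤˣ) (k l : α) : L v k = L v l := by
  have hentry (p k : α) : L (signFlip p) k = L (signFlip i) j := by
    by_cases hpk : p = k
    · rw [hpk, apply_signFlip_self hL i k, heq]
    · exact apply_signFlip_of_ne hL hij hpk
  exact mem_of_forall_signFlip_mem (H := ((Pi.evalMonoidHom _ k).comp L).eqLocus
    ((Pi.evalMonoidHom _ l).comp L)) (fun p => (hentry p k).trans (hentry p l).symm) v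

theorem forall_signFlip_mul_signFlip_mem_range_iff (hα : 3 ≤ Nat.card α) {i j : α} (hij : i ≠ j) :
    (∀ p q, p ≠ q → signFlip p * signFlip q ∈ L.range) ↔
      L (signFlip i) i ≠ L (signFlip i) j := by
  have := Nat.finite_of_card_ne_zero (α := α) (by lia)
  refine ⟨fun h heq => ?_, fun hne p q hpq => ⟨_, apply_signFlip_mul_signFlip hL hij hne hpq⟩⟩
  obtain ⟨r, hr⟩ := exists_notMem_of_card_lt_natCard (s := {i, j})
    (Finset.card_le_two.trans_lt (by lia))
  simp only [Finset.mem_insert, Finset.mem_singleton, not_or] at hr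
  obtain ⟨v, hv⟩ := h i j hij
  have := apply_eq_apply_of_signFlip_eq hL hij heq v i r
  rw [hv] at this
  simp [hij, hr.1, hr.2] at this

end SignVectors

namespace SignedPermGroup

open SemidirectProduct

variable {n : ℕ}

theorem normal_iff_forall_signFlip_mul_signFlip_mem {H : Subgroup (SignedPermGroup n)}
    (hH : H.map rightHom = ⊤) :
    H.Normal ↔ ∀ p q, p ≠ q → inl (signFlip p * signFlip q) ∈ H := by
  rw [normal_iff_forall_inl_mul_inv_mem hH]
  have hflip (σ : Perm (Fin n)) (p : Fin n) :
      signFlip p * (mulAutArrow σ (signFlip p))⁻¹ = signFlip p * signFlip (σ p) := by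
    rw [mulAutArrow_mulSingle, ← Pi.mulSingle_inv, Int.units_inv_eq_self]
  refine ⟨fun h p q _ => ?_, fun h σ v => ?_⟩
  · simpa only [hflip, swap_apply_left] using h (swap p q) (signFlip p)
  · let f : (Fin n → ℤˣ) →* (Fin n → ℤˣ) :=
      MonoidHom.id _ * ((mulAutArrow σ : MulAut (Fin n → ℤˣ)).toMonoidHom)⁻¹
    refine mem_of_forall_signFlip_mem (H := H.comap (inl.comp f)) (fun p => ?_) v
    change inl (signFlip p * (mulAutArrow σ (signFlip p))⁻¹) ∈ H
    rw [hflip]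
    by_cases hp : p = σ p
    · rw [← hp, ← Pi.mulSingle_mul, Int.units_mul_self, Pi.mulSingle_one, map_one]
      exact H.one_mem
    · exact h p (σ p) hp

section OverIdentity

variable {ψ : SignedPermGroup n →* SignedPermGroup n} (hψ : rightHom.comp ψ = rightHom)

theorem range_normal_iff (hn : 3 ≤ n) {i j : Fin n} (hij : i ≠ j) :
    ψ.range.Normal ↔ restrictInl hψ (signFlip i) i ≠ restrictInl hψ (signFlip i) j := by
  rw [normal_iff_forall_signFlip_mul_signFlip_mem (map_rightHom_range_eq_top hψ)]
  simp only [inl_mem_range_iff hψ]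
  exact forall_signFlip_mul_signFlip_mem_range_iff (restrictInl_aut hψ) (by simpa) hij

theorem range_twist_normal_iff (hn : 3 ≤ n) : (twist hψ).range.Normal ↔ ¬ ψ.range.Normal := by
  have : Nontrivial (Fin n) := Fin.nontrivial_iff_two_le.2 (by lia)
  obtain ⟨i, j, hij⟩ := exists_pair_ne (Fin n)
  rw [range_normal_iff (rightHom_comp_twist hψ) hn hij, range_normal_iff hψ hn hij,
    restrictInl_twist, signFlip, Pi.mul_apply, Pi.mul_apply, Pi.mulSingle_eq_same,
    Pi.mulSingle_eq_of_ne' hij, neg_one_mul, one_mul, Int.units_ne_iff_eq_neg, neg_inj, not_ne_iff]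

end OverIdentity

/-- The endomorphisms of `SignedPermGroup n` lying over the identity of the symmetric group. -/
abbrev EndOverIdentity (n : ℕ) : Type :=
  {ψ : SignedPermGroup n →* SignedPermGroup n // rightHom.comp ψ = rightHom}

/-- The involution `twist` as a permutation of the endomorphisms over the identity. -/
def twistEquiv (n : ℕ) : EndOverIdentity n ≃ EndOverIdentity n :=
  Function.Involutive.toPerm (fun ψ => ⟨twist ψ.2, rightHom_comp_twist ψ.2⟩) fun ψ =>
    Subtype.ext (twist_twist ψ.2 fun v => funext fun i => Int.units_mul_self (v i))

/-- An endomorphism over the identity followed by conjugation with a permutation `τ`; on the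
symmetric group it induces conjugation by `τ`. -/
def conjOver (x : Perm (Fin n) × EndOverIdentity n) : SignedPermGroup n →* SignedPermGroup n :=
  (MulAut.conj (inr x.1)).toMonoidHom.comp x.2

theorem right_conjOver (τ : Perm (Fin n)) (ψ : EndOverIdentity n) (g : SignedPermGroup n) :
    (conjOver (τ, ψ) g).right = MulAut.conj τ g.right := by
  simp [conjOver, right_apply_eq_right ψ.2]

theorem conjOver_injective (hn : 3 ≤ n) : Function.Injective (conjOver (n := n)) := by
  rintro ⟨τ, ψ⟩ ⟨τ', ψ'⟩ h
  obtain rfl : τ = τ' := mulAut_conj_injective (by simpa) <| MulEquiv.ext fun σ => by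
    simpa only [right_conjOver, right_inr] using congr(($h (inr σ)).right)
  obtain rfl : ψ = ψ' :=
    Subtype.ext (MonoidHom.ext fun g => (MulAut.conj (inr τ)).injective congr($h g))
  rfl

theorem range_conjOver_normal_iff (x : Perm (Fin n) × EndOverIdentity n) :
    (conjOver x).range.Normal ↔ x.2.1.range.Normal := by
  rw [conjOver, MonoidHom.range_comp]
  exact MulEquiv.normal_map_iff (f := MulAut.conj (inr x.1))

theorem mem_range_conjOver (hn : 7 ≤ n) {φ : SignedPermGroup n →* SignedPermGroup n}
    (hφ : Function.Injective (rightHom.comp (φ.comp inr))) : φ ∈ Set.range conjOver := by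
  obtain ⟨τ, hτ⟩ := mulAut_conj_surjective (by simpa)
    (MulEquiv.ofBijective _ (Finite.injective_iff_bijective.1 hφ))
  let ψ := (MulAut.conj (inr τ)).symm.toMonoidHom.comp φ
  have hinr : (rightHom.comp ψ).comp inr = MonoidHom.id (Perm (Fin n)) := MonoidHom.ext fun σ => by
    have hσ : τ * σ * τ⁻¹ = (φ (inr σ)).right := congr($hτ σ)
    simp [ψ, ← hσ, mul_assoc]
  have hinl : (rightHom.comp ψ).comp inl = 1 :=
    comp_inl_eq_one_of_surjective (by rw [Nat.card_fin]; lia) (by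
      rw [hinr]; exact Function.surjective_id)
  refine ⟨(τ, ⟨ψ, SemidirectProduct.hom_ext ?_ ?_⟩), ?_⟩
  · rw [hinl, rightHom_comp_inl]
  · rw [hinr, rightHom_comp_inr]
  · exact MonoidHom.ext fun g => (MulAut.conj (inr τ)).apply_symm_apply (φ g)

theorem mem_range_conjOver_or_alternatingGroup_le_ker (hn : 7 ≤ n)
    (φ : SignedPermGroup n →* SignedPermGroup n) :
    φ ∈ Set.range conjOver ∨ alternatingGroup (Fin n) ≤ (φ.comp inr).ker := by
  have hcard : 5 ≤ Nat.card (Fin n) := by rw [Nat.card_fin]; lia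
  by_cases hφ : Function.Injective (rightHom.comp (φ.comp inr))
  · exact .inl (mem_range_conjOver hn hφ)
  · exact .inr <| alternatingGroup_le_ker_of_rightHom_comp hcard
      (alternatingGroup_le_ker_of_not_injective hcard hφ)

section TrivialOnAlternatingGroup

/-- The product of the signs and the signature, which together detect the homomorphisms that are
trivial on the alternating group. -/
def signs (n : ℕ) : SignedPermGroup n →* ℤˣ × ℤˣ where
  toFun g := (∏ i, g.left i, Perm.sign g.right)
  map_one' := by simp
  map_mul' x y := by
    have hperm : ∏ i, mulAutArrow x.right y.left i = ∏ i, y.left i :=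
      Equiv.prod_comp x.right⁻¹ y.left
    simp only [mul_left, mul_right, map_mul, Pi.mul_apply, Finset.prod_mul_distrib, hperm,
      Prod.mk_mul_mk]

theorem signs_surjective (hn : 2 ≤ n) : Function.Surjective (signs n) := by
  rintro ⟨a, b⟩
  have : Nontrivial (Fin n) := Fin.nontrivial_iff_two_le.2 hn
  obtain ⟨i, -⟩ := exists_pair_ne (Fin n)
  obtain ⟨σ, rfl⟩ := Perm.sign_surjective (Fin n) b
  exact ⟨⟨Pi.mulSingle i a, σ⟩, by simp [signs]⟩

variable {K : Type*} [Group K] {φ : SignedPermGroup n →* K}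

theorem map_inl_signFlip_eq (hn : 3 ≤ n) (hφ : alternatingGroup (Fin n) ≤ (φ.comp inr).ker)
    (p q : Fin n) : φ (inl (signFlip p)) = φ (inl (signFlip q)) := by
  have := alternatingGroup.isPretransitive_of_three_le_card (Fin n) (by simpa)
  obtain ⟨⟨σ, hσ⟩, rfl⟩ := MulAction.exists_smul_eq (alternatingGroup (Fin n)) p q
  have hσφ : φ (inr σ) = 1 := hφ hσ
  change _ = φ (inl (signFlip (σ p)))
  rw [signFlip, signFlip, ← mulAutArrow_mulSingle, inl_aut, map_mul, map_mul, map_inv, map_inv, hσφ]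
  group

theorem map_inl_eq_map_inl_mulSingle_prod (hn : 3 ≤ n)
    (hφ : alternatingGroup (Fin n) ≤ (φ.comp inr).ker) (i : Fin n) (v : Fin n → ℤˣ) :
    φ (inl v) = φ (inl (Pi.mulSingle i (∏ j, v j))) := by
  let f : (Fin n → ℤˣ) →* K := (φ.comp inl).comp
    ((MonoidHom.mulSingle (fun _ => ℤˣ) i).comp (∏ j, Pi.evalMonoidHom _ j))
  have hf (v) : f v = φ (inl (Pi.mulSingle i (∏ j, v j))) := by simp [f]
  rw [← hf]
  refine mem_of_forall_signFlip_mem (H := (φ.comp inl).eqLocus f) (fun p => ?_) v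
  change φ (inl (signFlip p)) = f (signFlip p)
  rw [hf, map_inl_signFlip_eq hn hφ p i]
  simp

theorem ker_signs_le (hn : 3 ≤ n) (hφ : alternatingGroup (Fin n) ≤ (φ.comp inr).ker) :
    (signs n).ker ≤ φ.ker := by
  intro g hg
  obtain ⟨hleft, hright⟩ : ∏ i, g.left i = 1 ∧ Perm.sign g.right = 1 := Prod.ext_iff.1 hg
  have hσ : φ (inr g.right) = 1 := hφ (Perm.mem_alternatingGroup.2 hright)
  rw [MonoidHom.mem_ker, ← inl_left_mul_inr_right g, map_mul, hσ, mul_one,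
    map_inl_eq_map_inl_mulSingle_prod hn hφ ⟨0, by lia⟩, hleft]
  simp

theorem natCard_alternatingGroup_le_ker_le (hn : 3 ≤ n) [Finite K] :
    Nat.card {φ : SignedPermGroup n →* K // alternatingGroup (Fin n) ≤ (φ.comp inr).ker} ≤
      Nat.card (ℤˣ × ℤˣ →* K) := by
  have : Finite (SignedPermGroup n →* K) := DFunLike.finite _
  have : Finite (ℤˣ × ℤˣ →* K) := DFunLike.finite _
  obtain ⟨s, hs⟩ := (signs_surjective (by lia : 2 ≤ n)).hasRightInverse
  rw [← Nat.card_congr ((signs n).liftOfRightInverse s hs)]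
  exact Nat.card_le_card_of_injective (Subtype.map id fun φ => ker_signs_le hn)
    (Subtype.map_injective _ Function.injective_id)

end TrivialOnAlternatingGroup

theorem natCard_notMem_range_conjOver_le (hn : 7 ≤ n) :
    Nat.card {φ : SignedPermGroup n →* SignedPermGroup n // φ ∉ Set.range conjOver} ≤
      16 ^ n * Nat.card (ℤˣ × ℤˣ →* Perm (Fin n)) :=
  calc
    _ ≤ Nat.card {φ : SignedPermGroup n →* SignedPermGroup n //
          alternatingGroup (Fin n) ≤ (φ.comp inr).ker} :=
      Nat.card_le_card_of_injective (Subtype.map id fun φ =>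
        (mem_range_conjOver_or_alternatingGroup_le_ker hn φ).resolve_left)
        (Subtype.map_injective _ Function.injective_id)
    _ ≤ Nat.card (ℤˣ × ℤˣ →* SignedPermGroup n) := natCard_alternatingGroup_le_ker_le (by lia)
    _ ≤ Nat.card (Fin n → ℤˣ) ^ Nat.card (ℤˣ × ℤˣ) * Nat.card (ℤˣ × ℤˣ →* Perm (Fin n)) :=
      natCard_monoidHom_semidirectProduct_le _
    _ = 16 ^ n * Nat.card (ℤˣ × ℤˣ →* Perm (Fin n)) := by
      have h2 : Nat.card ℤˣ = 2 := by simp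
      rw [Nat.card_prod, h2, Nat.card_fun, h2, Nat.card_fin, ← pow_mul, mul_comm n, pow_mul]
      norm_num

theorem factorial_le_natCard_end (hn : 3 ≤ n) :
    n.factorial ≤ Nat.card (SignedPermGroup n →* SignedPermGroup n) := by
  have hinj : Function.Injective fun τ : Perm (Fin n) =>
      conjOver (τ, ⟨MonoidHom.id _, MonoidHom.comp_id _⟩) :=
    (conjOver_injective hn).comp (Prod.mk_left_injective _)
  calc n.factorial = Nat.card (Perm (Fin n)) := by rw [Nat.card_perm, Nat.card_fin]
    _ ≤ _ := Nat.card_le_card_of_injective _ hinj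

end SignedPermGroup

theorem abs_uniformProb_sub_half_le {α β : Type} [Finite α] [Nonempty α] {P : α → Prop}
    {j : β → α} (hj : Function.Injective j) (e : β ≃ β) (he : ∀ b, P (j (e b)) ↔ ¬ P (j b)) :
    |uniformProb α P - 1 / 2| ≤ uniformProb α fun a => a ∉ Set.range j := by
  have : Finite β := Finite.of_injective j hj
  have hhalf : Nat.card {b // ¬ P (j b)} = Nat.card {b // P (j b)} :=
    Nat.card_congr (e.subtypeEquiv fun b => (he b).symm)
  have hβ : Nat.card {b // P (j b)} + Nat.card {b // ¬ P (j b)} = Nat.card β := by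
    classical rw [← Nat.card_sum, Nat.card_congr (Equiv.sumCompl _)]
  have hα : Nat.card {a // P a} + Nat.card {a // ¬ P a} = Nat.card α := by
    classical rw [← Nat.card_sum, Nat.card_congr (Equiv.sumCompl _)]
  have hrange : Nat.card β + Nat.card {a // a ∉ Set.range j} = Nat.card α := by
    classical rw [Nat.card_congr (Equiv.ofInjective j hj), ← Nat.card_sum,
      Nat.card_congr (Equiv.sumCompl (· ∈ Set.range j))]
  have hle (Q : α → Prop) : Nat.card {b // Q (j b)} ≤ Nat.card {a // Q a} :=
    Nat.card_le_card_of_injective (Subtype.map j fun _ => id) (Subtype.map_injective _ hj)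
  have hP : Nat.card {b // P (j b)} ≤ Nat.card {a // P a} := hle P
  have hnotP : Nat.card {b // ¬ P (j b)} ≤ Nat.card {a // ¬ P a} := hle fun a => ¬ P a
  have hpos : (0 : ℝ) < Nat.card α := by exact_mod_cast Nat.card_pos
  rify at hhalf hβ hα hrange hP hnotP
  rw [uniformProb, uniformProb, div_sub' hpos.ne', abs_div, abs_of_pos hpos]
  gcongr
  rw [abs_le]
  constructor <;> linarith

theorem mainTheorem7 :
    Filter.Tendsto
      (fun n : ℕ =>
        uniformProb (SignedPermGroup n →* SignedPermGroup n) (fun φ => φ.range.Normal))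
      Filter.atTop (nhds (1 / 2 : ℝ)) := by
  rw [tendsto_iff_norm_sub_tendsto_zero]
  refine squeeze_zero' (.of_forall fun n => norm_nonneg _) ?_
    (tendsto_natCard_monoidHom_perm_mul_pow_div_factorial (ℤˣ × ℤˣ) (K := 16) (by norm_num))
  filter_upwards [eventually_ge_atTop 7] with n hn
  have hn3 : 3 ≤ n := by lia
  calc |uniformProb (SignedPermGroup n →* SignedPermGroup n) (fun φ => φ.range.Normal) - 1 / 2|
    _ ≤ uniformProb (SignedPermGroup n →* SignedPermGroup n)
        (· ∉ Set.range SignedPermGroup.conjOver) :=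
      abs_uniformProb_sub_half_le (SignedPermGroup.conjOver_injective hn3)
        ((Equiv.refl _).prodCongr (SignedPermGroup.twistEquiv n)) fun x => by
          rw [SignedPermGroup.range_conjOver_normal_iff, SignedPermGroup.range_conjOver_normal_iff]
          exact SignedPermGroup.range_twist_normal_iff x.2.2 hn3
    _ ≤ Nat.card (ℤˣ × ℤˣ →* Perm (Fin n)) * 16 ^ n / n.factorial := by
      rw [uniformProb, mul_comm]
      gcongr
      · exact_mod_cast SignedPermGroup.natCard_notMem_range_conjOver_le hn
      · exact SignedPermGroup.factorial_le_natCard_end hn3
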